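/- Let $d \ge 1$. For a compact set $C \subset \mathbb{R}^d$, the bounded path-connected components of the complement $\mathbb{R}^d \setminus C$ are called the bounded gaps of $C$, and $E$ denotes the unbounded path-connected component of $\mathbb{R}^d\setminus C$ (if $d = 1$, the union of the unbounded components). If $C$ has at least one bounded gap, list the (at most countably many, possibly finitely many) bounded gaps as $G_1, G_2, \dots$ in order of non-increasing diameter; the thickness of $C$ is $$\tau(C) := \inf_{n} \frac{\operatorname{dist}\bigl(G_n,\ \bigcup_{1 \le i \le n-1} G_i \cup E\bigr)}{\operatorname{diam}(G_n)},$$ where $\operatorname{dist}(A,B) = \inf\{|a-b| : a \in A,\ b \in B\}$. (The value does not depend on the choice of such a listing; if no such listing exists, put $\tau(C) := 0$.) If $C$ has no bounded gap, put $\tau(C) := +\infty$ when $C$ has non-empty interior and $\tau(C) := 0$ when $C$ has empty interior. The convention $0 \cdot \infty = 0$ is used for products of thicknesses. For $x \in \mathbb{R}^{2d}$ and $A \subset \mathbb{R}^{2d}$ let $\Delta_x(A) := \{|x - y| : y \in A\}$, where $|\cdot|$ is the Euclidean norm. Theorem. Let $C_1, C_2 \subset \mathbb{R}^d$ be compact sets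 with $\tau(C_1)\,\tau(C_2) > 1$. Then for every $x^0 \in C_1 \times C_2 \subset \mathbb{R}^{2d}$ there is an open neighborhood $S \subset \mathbb{R}^{2d}$ of $x^0$ such that $$\bigcap_{x \in S} \Delta_x(C_1 \times C_2)$$ has non-empty interior in $\mathbb{R}$. -/

import Mathlib

open Set
open scoped ENNReal

/-- Euclidean space `ℝ^d`. -/
abbrev Rd (d : ℕ) : Type := EuclideanSpace ℝ (Fin d)

/-- `ℝ^{2d}`, written as `ℝ^d × ℝ^d` with the Euclidean (`ℓ²`) norm. -/
abbrev R2d (d : ℕ) : Type := WithLp 2 (Rd d × Rd d)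

/-- The product `C₁ × C₂` as a subset of `ℝ^{2d}`. -/
def prodSet {d : ℕ} (C₁ C₂ : Set (Rd d)) : Set (R2d d) :=
  {p | p.fst ∈ C₁ ∧ p.snd ∈ C₂}

/-- The pinned distance set `Δ_x(A) = {|x - y| : y ∈ A}`. -/
def pinnedDist {d : ℕ} (x : R2d d) (A : Set (R2d d)) : Set ℝ :=
  {t | ∃ y ∈ A, t = ‖x - y‖}

section Thickness

variable {d : ℕ}

/-- The path-connected components of the complement of `C`. -/
def complComponents (C : Set (Rd d)) : Set (Set (Rd d)) :=
  {G | ∃ x ∈ Cᶜ, G = pathComponentIn Cᶜ x}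

/-- The bounded gaps of `C`. -/
def boundedGaps (C : Set (Rd d)) : Set (Set (Rd d)) :=
  {G | G ∈ complComponents C ∧ Bornology.IsBounded G}

/-- The unbounded gap `E` of `C`: the unbounded path-connected component of the complement
(for `d = 1`, the union of the two unbounded components). -/
def unboundedGap (C : Set (Rd d)) : Set (Rd d) :=
  ⋃₀ {G | G ∈ complComponents C ∧ ¬ Bornology.IsBounded G}

/-- The distance between two sets, `inf {|a - b| : a ∈ A, b ∈ B}`, with values in `[0, ∞]`. -/
noncomputable def setEDist (A B : Set (Rd d)) : ℝ≥0∞ :=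
  ⨅ a ∈ A, ⨅ b ∈ B, edist a b

/-- `G 0, G 1, …` (all indices `n < N`, where `N ≤ ∞`) lists every bounded gap of `C` exactly
once, in order of non-increasing diameter. -/
structure IsGapSequence (C : Set (Rd d)) (N : ℕ∞) (G : ℕ → Set (Rd d)) : Prop where
  bijOn : BijOn G {n : ℕ | (n : ℕ∞) < N} (boundedGaps C)
  antitone : ∀ m n : ℕ, m ≤ n → (n : ℕ∞) < N → Metric.ediam (G n) ≤ Metric.ediam (G m)

/-- `inf_n dist(G_n, ⋃_{i < n} G_i ∪ E) / diam(G_n)`. -/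
noncomputable def seqThickness (C : Set (Rd d)) (N : ℕ∞) (G : ℕ → Set (Rd d)) : ℝ≥0∞ :=
  ⨅ (n : ℕ) (_ : (n : ℕ∞) < N),
    setEDist (G n) ((⋃ (i : ℕ) (_ : i < n), G i) ∪ unboundedGap C) / Metric.ediam (G n)

open Classical in
/-- The thickness of `C`, with values in `[0, ∞]`. If `C` has bounded gaps, it is the number
`seqThickness C N G` for a listing `G` of the bounded gaps by non-increasing diameter. This number
is the same for all such listings (see `thickness_eq_seqThickness`), so the supremum only selects
it; if there is no such listing, the thickness is `0`. -/
noncomputable def thickness (C : Set (Rd d)) : ℝ≥0∞ :=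
  if (boundedGaps C).Nonempty then
    ⨆ (N : ℕ∞) (G : ℕ → Set (Rd d)) (_ : IsGapSequence C N G), seqThickness C N G
  else if (interior C).Nonempty then ⊤ else 0

theorem setEDist_comm (A B : Set (Rd d)) : setEDist A B = setEDist B A := by
  unfold setEDist
  rw [iInf₂_comm]
  simp only [edist_comm]

theorem setEDist_anti (A : Set (Rd d)) {B B' : Set (Rd d)} (h : B ⊆ B') :
    setEDist A B' ≤ setEDist A B :=
  iInf₂_mono fun _ _ => biInf_mono h

theorem ediam_boundedGap_ne (hd : 1 ≤ d) {C G : Set (Rd d)} (hC : IsCompact C)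
    (hG : G ∈ boundedGaps C) : Metric.ediam G ≠ 0 ∧ Metric.ediam G ≠ ⊤ := by
  obtain ⟨⟨x, hx, rfl⟩, hb⟩ := hG
  have : NeZero d := ⟨by omega⟩
  refine ⟨fun h => ?_, hb.ediam_ne_top⟩
  have ho : IsOpen (pathComponentIn Cᶜ x) := hC.isClosed.isOpen_compl.pathComponentIn x
  have hs := Metric.ediam_eq_zero_iff.1 h
  have hxm : x ∈ pathComponentIn Cᶜ x := mem_pathComponentIn_self hx
  have : pathComponentIn Cᶜ x = {x} := hs.eq_singleton_of_mem hxm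
  rw [this] at ho
  exact not_isOpen_singleton x ho

theorem seqThickness_le (hd : 1 ≤ d) {C : Set (Rd d)} (hC : IsCompact C) {N N' : ℕ∞}
    {G G' : ℕ → Set (Rd d)} (h : IsGapSequence C N G) (h' : IsGapSequence C N' G') :
    seqThickness C N' G' ≤ seqThickness C N G := by
  refine le_iInf₂ fun n hn => ?_
  obtain ⟨h0, ht⟩ := ediam_boundedGap_ne hd hC (h.bijOn.mapsTo hn)
  rw [ENNReal.le_div_iff_mul_le (Or.inl h0) (Or.inl ht)]
  obtain ⟨n', hn', e⟩ := h'.bijOn.surjOn (h.bijOn.mapsTo hn)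
  have key : ∀ k : ℕ, (k : ℕ∞) < N' → ∀ B, B ⊆ (⋃ (i : ℕ) (_ : i < k), G' i) ∪ unboundedGap C →
      seqThickness C N' G' * Metric.ediam (G' k) ≤ setEDist (G' k) B := by
    intro k hk B hB
    obtain ⟨h0, ht⟩ := ediam_boundedGap_ne hd hC (h'.bijOn.mapsTo hk)
    rw [← ENNReal.le_div_iff_mul_le (Or.inl h0) (Or.inl ht)]
    exact (iInf₂_le k hk).trans (ENNReal.div_le_div_right (setEDist_anti _ hB) _)
  refine le_iInf₂ fun a ha => le_iInf₂ fun b hb => ?_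
  rcases hb with hb | hb
  · simp only [mem_iUnion] at hb
    obtain ⟨i, hi, hb⟩ := hb
    have hiN : (i : ℕ∞) < N := lt_trans (by exact_mod_cast hi) hn
    obtain ⟨i', hi', e'⟩ := h'.bijOn.surjOn (h.bijOn.mapsTo hiN)
    have hne : i' ≠ n' := by
      rintro rfl
      exact hi.ne (h.bijOn.injOn hiN hn (e'.symm.trans e))
    rcases hne.lt_or_gt with hlt | hlt
    · have := key n' hn' (G' i') (fun y hy => Or.inl (mem_iUnion₂.2 ⟨i', hlt, hy⟩))
      rw [e, e'] at this
      exact this.trans ((iInf₂_le a ha).trans (iInf₂_le b hb))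
    · have := key i' hi' (G' n') (fun y hy => Or.inl (mem_iUnion₂.2 ⟨n', hlt, hy⟩))
      have hdiam := h.antitone i n hi.le hn
      rw [e, e', setEDist_comm] at this
      exact (mul_le_mul_right hdiam _).trans
        (this.trans ((iInf₂_le a ha).trans (iInf₂_le b hb)))
  · have := key n' hn' (unboundedGap C) subset_union_right
    rw [e] at this
    exact this.trans ((iInf₂_le a ha).trans (iInf₂_le b hb))

/-- The thickness can be computed from any listing of the bounded gaps by non-increasing
diameter. -/
theorem thickness_eq_seqThickness (hd : 1 ≤ d) {C : Set (Rd d)} (hC : IsCompact C)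
    (hne : (boundedGaps C).Nonempty) {N : ℕ∞} {G : ℕ → Set (Rd d)}
    (h : IsGapSequence C N G) : thickness C = seqThickness C N G := by
  rw [thickness, if_pos hne]
  refine le_antisymm (iSup_le fun N' => iSup_le fun G' => iSup_le fun h' =>
    seqThickness_le hd hC h h') ?_
  exact le_iSup_of_le N (le_iSup_of_le G (le_iSup_of_le h le_rfl))

end Thickness

/-! It suffices to find `t₀` such that, for all `(x, t)` near `(x₀, t₀)`, `t` is a distance from `x`
to `C₁ × C₂`.

If a factor has interior, that factor alone provides the distances, the other coordinate being
frozen at that of `x₀`. The same works for `d ≥ 2` when the interiors are empty: thickness forces a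
gap of `C₁` close to a given gap `G`, but outside its closure, to be small. A sphere around a point
near `x₀.fst` that passes through this small gap is path connected and too wide to stay in it, so it
meets `C₁` (`exists_radius_of_small_gap`).

For `d = 1` spheres are disconnected and both factors are needed. The sets of values `(y₁ - x₁) ^ 2`
and `t ^ 2 - (y₂ - x₂) ^ 2` must meet, which is Newhouse's gap lemma (`IsThick.inter_nonempty`): in
disjoint thick sets, any linked pair of gaps could be replaced by a linked pair of smaller total
length, against compactness. Squaring is nearly affine on short pieces away from the pin, so it
costs only a factor `ρ` close to `1` of thickness; `IsThick.exists_short_piece` supplies pieces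
which are still thick. -/

open Filter Topology

/-! ### Gaps and thickness on the real line -/

/-- The interval `(a, b)` is a bounded gap of the set `K` of reals. -/
def IsGap (K : Set ℝ) (a b : ℝ) : Prop :=
  a ∈ K ∧ b ∈ K ∧ a < b ∧ ∀ x ∈ K, x ≤ a ∨ b ≤ x

/-- The compact set `K` of reals has convex hull `[m, M]` and thickness at least `τ`. -/
structure IsThick (K : Set ℝ) (τ m M : ℝ) : Prop where
  isCompact : IsCompact K
  left_mem : m ∈ K
  right_mem : M ∈ K
  subset : K ⊆ Icc m M
  left_le : ∀ a b, IsGap K a b → τ * (b - a) ≤ a - m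
  right_le : ∀ a b, IsGap K a b → τ * (b - a) ≤ M - b
  sep : ∀ a b c d, IsGap K a b → IsGap K c d → b ≤ c → τ * min (b - a) (d - c) ≤ c - b

theorem exists_isGap {K : Set ℝ} (hK : IsClosed K) {m M z : ℝ} (hm : m ∈ K) (hM : M ∈ K)
    (hz : z ∉ K) (hmz : m ≤ z) (hzM : z ≤ M) : ∃ a b,
    IsGap K a b ∧ m ≤ a ∧ a < z ∧ z < b ∧ b ≤ M := by
  obtain ⟨a, ⟨haK, ha⟩, ha'⟩ := (isCompact_Icc.inter_left hK : IsCompact (K ∩ Icc m z)).exists_isGreatest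
    ⟨m, hm, le_rfl, hmz⟩
  obtain ⟨b, ⟨hbK, hb⟩, hb'⟩ := (isCompact_Icc.inter_left hK : IsCompact (K ∩ Icc z M)).exists_isLeast
    ⟨M, hM, hzM, le_rfl⟩
  have haz : a < z := lt_of_le_of_ne ha.2 (by rintro rfl; exact hz haK)
  have hzb : z < b := lt_of_le_of_ne hb.1 (by rintro rfl; exact hz hbK)
  refine ⟨a, b, ⟨haK, hbK, haz.trans hzb, fun x hx => ?_⟩, ha.1, haz, hzb, hb.2⟩
  rcases le_total x z with h | h
  · left
    rcases le_total m x with h' | h'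
    · exact ha' ⟨hx, h', h⟩
    · exact h'.trans ha.1
  · right
    rcases le_total x M with h' | h'
    · exact hb' ⟨hx, h, h'⟩
    · exact hb.2.trans h'

theorem IsGap.neg {K : Set ℝ} {a b : ℝ} (h : IsGap K a b) : IsGap (-K) (-b) (-a) := by
  obtain ⟨ha, hb, hab, h⟩ := h
  refine ⟨by simpa, by simpa, by linarith, fun x hx => ?_⟩
  rcases h (-x) hx with h | h
  · right; linarith
  · left; linarith

theorem IsGap.of_neg {K : Set ℝ} {a b : ℝ} (h : IsGap (-K) a b) : IsGap K (-b) (-a) := by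
  simpa using h.neg

theorem IsThick.neg {K : Set ℝ} {τ m M : ℝ} (h : IsThick K τ m M) :
    IsThick (-K) τ (-M) (-m) where
  isCompact := h.isCompact.neg
  left_mem := by simpa using h.right_mem
  right_mem := by simpa using h.left_mem
  subset := fun x hx => by
    have := h.subset hx
    exact ⟨by linarith [this.2], by linarith [this.1]⟩
  left_le := fun a b hg => by linarith [h.right_le _ _ hg.of_neg]
  right_le := fun a b hg => by linarith [h.left_le _ _ hg.of_neg]
  sep := fun a b c d hg hg' hbc => by
    have := h.sep _ _ _ _ hg'.of_neg hg.of_neg (by linarith)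
    rw [min_comm] at this
    rwa [show -a - -b = b - a by ring, show -c - -d = d - c by ring,
      show -b - -c = c - b by ring] at this

/-- A monotone map which distorts lengths by a factor at most `ρ⁻¹` decreases the thickness by a
factor at most `ρ`. -/
theorem IsThick.image {K : Set ℝ} {τ m M ρ A B : ℝ} (h : IsThick K τ m M) {f : ℝ → ℝ}
    (hf : ContinuousOn f K) (hτ : 0 ≤ τ) (hρ : 0 ≤ ρ) (hA : 0 < A) (hAB : ρ * B ≤ A)
    (hfA : ∀ x ∈ K, ∀ y ∈ K, x ≤ y → A * (y - x) ≤ f y - f x)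
    (hfB : ∀ x ∈ K, ∀ y ∈ K, x ≤ y → f y - f x ≤ B * (y - x)) :
    IsThick (f '' K) (ρ * τ) (f m) (f M) := by
  have hmono : ∀ x ∈ K, ∀ y ∈ K, x ≤ y → f x ≤ f y := fun x hx y hy hxy => by
    nlinarith [hfA x hx y hy hxy]
  have hlt : ∀ x ∈ K, ∀ y ∈ K, f x < f y → x < y := fun x hx y hy hxy => by
    by_contra hc
    linarith [hmono y hy x hx (not_lt.1 hc)]
  have hgap : ∀ p q, IsGap (f '' K) p q → ∃ a b, IsGap K a b ∧ p = f a ∧ q = f b := by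
    rintro _ _ ⟨⟨a, ha, rfl⟩, ⟨b, hb, rfl⟩, hab, hg⟩
    refine ⟨a, b, ⟨ha, hb, hlt a ha b hb hab, fun x hx => ?_⟩, rfl, rfl⟩
    by_contra! hc
    have h1 := hfA a ha x hx hc.1.le
    have h2 := hfA x hx b hb hc.2.le
    have h3 := mul_pos hA (sub_pos.2 hc.1)
    have h4 := mul_pos hA (sub_pos.2 hc.2)
    rcases hg (f x) ⟨x, hx, rfl⟩ with h | h <;> linarith
  -- Gaps grow by a factor at most `B`, the distances compared with them by at least `A ≥ ρ * B`;
  -- all three thickness conditions transfer through this bound.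
  have hlen : ∀ a b, IsGap K a b → ρ * τ * (f b - f a) ≤ A * (τ * (b - a)) := by
    rintro a b ⟨ha, hb, hab, -⟩
    have h1 := hfB a ha b hb hab.le
    have h2 := mul_le_mul_of_nonneg_left h1 (mul_nonneg hρ hτ)
    have h3 := mul_le_mul_of_nonneg_right hAB (mul_nonneg hτ (sub_nonneg.2 hab.le))
    nlinarith
  refine ⟨h.isCompact.image_of_continuousOn hf, ⟨m, h.left_mem, rfl⟩, ⟨M, h.right_mem, rfl⟩,
    ?_, ?_, ?_, ?_⟩
  · rintro _ ⟨x, hx, rfl⟩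
    exact ⟨hmono m h.left_mem x hx (h.subset hx).1, hmono x hx M h.right_mem (h.subset hx).2⟩
  · intro p q hg
    obtain ⟨a, b, hab, rfl, rfl⟩ := hgap p q hg
    exact (hlen a b hab).trans ((mul_le_mul_of_nonneg_left (h.left_le a b hab) hA.le).trans
      (hfA m h.left_mem a hab.1 (h.subset hab.1).1))
  · intro p q hg
    obtain ⟨a, b, hab, rfl, rfl⟩ := hgap p q hg
    exact (hlen a b hab).trans ((mul_le_mul_of_nonneg_left (h.right_le a b hab) hA.le).trans
      (hfA b hab.2.1 M h.right_mem (h.subset hab.2.1).2))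
  · intro p q r s hg hg' hle
    obtain ⟨a, b, hab, rfl, rfl⟩ := hgap p q hg
    obtain ⟨c, d, hcd, rfl, rfl⟩ := hgap r s hg'
    have hbc : b ≤ c := by
      by_contra! hc
      have := hfA c hcd.1 b hab.2.1 hc.le
      nlinarith [mul_pos hA (sub_pos.2 hc)]
    refine le_trans ?_ ((mul_le_mul_of_nonneg_left (h.sep a b c d hab hcd hbc) hA.le).trans
      (hfA b hab.2.1 c hcd.1 hbc))
    rw [mul_min_of_nonneg _ _ (mul_nonneg hρ hτ), mul_min_of_nonneg _ _ hτ,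
      mul_min_of_nonneg _ _ hA.le]
    exact min_le_min (hlen a b hab) (hlen c d hcd)

/-! ### Newhouse's gap lemma -/

/-- From a linked pair of gaps of two disjoint thick sets one gets a smaller linked pair. -/
theorem IsThick.exists_smaller_linked {K₁ K₂ : Set ℝ} {τ₁ τ₂ m₁ M₁ m₂ M₂ : ℝ}
    (h₁ : IsThick K₁ τ₁ m₁ M₁) (h₂ : IsThick K₂ τ₂ m₂ M₂) (hτ₂ : 0 < τ₂)
    (hτ : 1 < τ₁ * τ₂) (hdisj : ∀ x ∈ K₁, x ∉ K₂) {a b c d : ℝ} (hg₁ : IsGap K₁ a b)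
    (hg₂ : IsGap K₂ c d) (hac : a < c) (hcb : c < b) (hbd : b < d) :
    (∃ a' b', IsGap K₁ a' b' ∧ c < a' ∧ a' < d ∧ d < b' ∧ b' - a' < b - a) ∨
      ∃ c' d', IsGap K₂ c' d' ∧ c' < a ∧ a < d' ∧ d' < b ∧ d' - c' < d - c := by
  -- If both failed, then `τ₁ * τ₂ * (b - a) ≤ τ₂ * (d - c) ≤ b - a`, against `1 < τ₁ * τ₂`.
  have key : d - c < τ₁ * (b - a) ∨ b - a < τ₂ * (d - c) := by
    by_contra! hc
    have h3 := mul_le_mul_of_nonneg_left hc.1 hτ₂.le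
    have : 0 < b - a := by linarith
    nlinarith
  rcases key with h | h
  · left
    have hr := h₁.right_le a b hg₁
    -- Since `d - b < d - c < τ₁ * (b - a)`, the point `d` lies in the hull of `K₁`, and the gap of
    -- `K₁` around it is too close to `(a, b)` to be as long.
    have hd : d ∉ K₁ := fun hd => hdisj d hd hg₂.2.1
    obtain ⟨a', b', hg, hba, had, hdb, -⟩ :=
      exists_isGap h₁.isCompact.isClosed hg₁.2.1 h₁.right_mem hd hbd.le (by linarith)
    refine ⟨a', b', hg, by linarith, had, hdb, ?_⟩
    by_contra! hc
    have := h₁.sep a b a' b' hg₁ hg hba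
    rw [min_eq_left hc] at this
    linarith
  · right
    have hr := h₂.left_le c d hg₂
    have ha : a ∉ K₂ := hdisj a hg₁.1
    obtain ⟨c', d', hg, -, hca, had, hdc⟩ :=
      exists_isGap h₂.isCompact.isClosed h₂.left_mem hg₂.1 ha (by linarith) hac.le
    refine ⟨c', d', hg, hca, had, by linarith, ?_⟩
    by_contra! hc
    have := h₂.sep c' d' c d hg hg₂ hdc
    rw [min_eq_right hc] at this
    linarith

/-- The quadruples of endpoints of (possibly degenerate) linked gaps. -/
def linkedQuads (K₁ K₂ : Set ℝ) : Set (ℝ × ℝ × ℝ × ℝ) :=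
  {p | (∀ x ∈ K₁, x ≤ p.1 ∨ p.2.1 ≤ x) ∧ (∀ x ∈ K₂, x ≤ p.2.2.1 ∨ p.2.2.2 ≤ x) ∧
    p.1 ≤ p.2.2.1 ∧ p.2.2.1 ≤ p.2.1 ∧ p.2.1 ≤ p.2.2.2} ∩ (K₁ ×ˢ K₁ ×ˢ K₂ ×ˢ K₂)

theorem isClosed_setOf_gap (K : Set ℝ) :
    IsClosed {p : ℝ × ℝ | ∀ x ∈ K, x ≤ p.1 ∨ p.2 ≤ x} := by
  have : {p : ℝ × ℝ | ∀ x ∈ K, x ≤ p.1 ∨ p.2 ≤ x} =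
      ⋂ x ∈ K, ({p | x ≤ p.1} ∪ {p | p.2 ≤ x}) := by
    ext; simp
  rw [this]
  exact isClosed_biInter fun x _ =>
    (isClosed_le (by fun_prop) (by fun_prop)).union (isClosed_le (by fun_prop) (by fun_prop))

theorem isCompact_linkedQuads {K₁ K₂ : Set ℝ} (h₁ : IsCompact K₁) (h₂ : IsCompact K₂) :
    IsCompact (linkedQuads K₁ K₂) := by
  refine (h₁.prod (h₁.prod (h₂.prod h₂))).inter_left ?_
  have e1 := (isClosed_setOf_gap K₁).preimage
    (f := fun p : ℝ × ℝ × ℝ × ℝ => (p.1, p.2.1)) (by fun_prop)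
  have e2 := (isClosed_setOf_gap K₂).preimage
    (f := fun p : ℝ × ℝ × ℝ × ℝ => (p.2.2.1, p.2.2.2)) (by fun_prop)
  have e3 : IsClosed {p : ℝ × ℝ × ℝ × ℝ | p.1 ≤ p.2.2.1} :=
    isClosed_le (by fun_prop) (by fun_prop)
  have e4 : IsClosed {p : ℝ × ℝ × ℝ × ℝ | p.2.2.1 ≤ p.2.1} :=
    isClosed_le (by fun_prop) (by fun_prop)
  have e5 : IsClosed {p : ℝ × ℝ × ℝ × ℝ | p.2.1 ≤ p.2.2.2} :=
    isClosed_le (by fun_prop) (by fun_prop)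
  exact e1.inter (e2.inter (e3.inter (e4.inter e5)))

/-- The weak inequalities make `linkedQuads` closed; disjointness turns them back into strict ones.
The new gap links on the other side, so the two sets exchange roles. -/
theorem IsThick.exists_smaller_linkedQuads {K₁ K₂ : Set ℝ} {τ₁ τ₂ m₁ M₁ m₂ M₂ : ℝ}
    (h₁ : IsThick K₁ τ₁ m₁ M₁) (h₂ : IsThick K₂ τ₂ m₂ M₂) (hτ₂ : 0 < τ₂)
    (hτ : 1 < τ₁ * τ₂) (hdisj : ∀ x ∈ K₁, x ∉ K₂) {p : ℝ × ℝ × ℝ × ℝ}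
    (hp : p ∈ linkedQuads K₁ K₂) : ∃ q ∈ linkedQuads K₂ K₁,
      (q.2.1 - q.1) + (q.2.2.2 - q.2.2.1) < (p.2.1 - p.1) + (p.2.2.2 - p.2.2.1) := by
  obtain ⟨a, b, c, d⟩ := p
  obtain ⟨⟨hab, hcd, hac, hcb, hbd⟩, ha, hb, hc, hd⟩ := hp
  simp only at hab hcd hac hcb hbd ha hb hc hd ⊢
  replace hac := lt_of_le_of_ne hac (by rintro rfl; exact hdisj _ ha hc)
  replace hcb := lt_of_le_of_ne hcb (by rintro rfl; exact hdisj _ hb hc)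
  replace hbd := lt_of_le_of_ne hbd (by rintro rfl; exact hdisj _ hb hd)
  rcases h₁.exists_smaller_linked h₂ hτ₂ hτ hdisj ⟨ha, hb, hac.trans hcb, hab⟩
    ⟨hc, hd, hcb.trans hbd, hcd⟩ hac hcb hbd with
    ⟨a', b', ⟨ha', hb', -, hg⟩, h1, h2, h3, h4⟩ | ⟨c', d', ⟨hc', hd', -, hg⟩, h1, h2, h3, h4⟩
  · exact ⟨(c, d, a', b'), ⟨⟨hcd, hg, h1.le, h2.le, h3.le⟩, hc, hd, ha', hb'⟩, by
      simp only; linarith⟩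
  · exact ⟨(c', d', a, b), ⟨⟨hg, hab, h1.le, h2.le, h3.le⟩, hc', hd', ha, hb⟩, by
      simp only; linarith⟩

/-- Newhouse's gap lemma, for sets whose convex hulls overlap without being nested. -/
theorem IsThick.inter_nonempty {K₁ K₂ : Set ℝ} {τ₁ τ₂ m₁ M₁ m₂ M₂ : ℝ}
    (h₁ : IsThick K₁ τ₁ m₁ M₁) (h₂ : IsThick K₂ τ₂ m₂ M₂) (hτ₁ : 0 < τ₁) (hτ₂ : 0 < τ₂)
    (hτ : 1 < τ₁ * τ₂) (h12 : m₁ < m₂) (h21 : m₂ < M₁) (hM : M₁ < M₂) :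
    (K₁ ∩ K₂).Nonempty := by
  by_contra hne
  have hdisj : ∀ x ∈ K₁, x ∉ K₂ := fun x hx hx' => hne ⟨x, hx, hx'⟩
  have hdisj' : ∀ x ∈ K₂, x ∉ K₁ := fun x hx hx' => hne ⟨x, hx', hx⟩
  -- A first linked pair: the gap of `K₁` around `m₂`, then the gap of `K₂` around the right end `b`
  -- of that gap, where `b ≤ M₁ < M₂`.
  have hQ : (linkedQuads K₁ K₂ ∪ linkedQuads K₂ K₁).Nonempty := by
    obtain ⟨a, b, hab, -, ham, hmb, hbM⟩ := exists_isGap h₁.isCompact.isClosed h₁.left_mem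
      h₁.right_mem (hdisj' _ h₂.left_mem) h12.le h21.le
    obtain ⟨c, d, hcd, hmc, hcb, hbd, -⟩ := exists_isGap h₂.isCompact.isClosed h₂.left_mem
      h₂.right_mem (hdisj _ hab.2.1) hmb.le (by linarith)
    exact ⟨(a, b, c, d), Or.inl ⟨⟨hab.2.2.2, hcd.2.2.2, (ham.trans_le hmc).le, hcb.le, hbd.le⟩,
      hab.1, hab.2.1, hcd.1, hcd.2.1⟩⟩
  obtain ⟨p, hp, hmin⟩ := ((isCompact_linkedQuads h₁.isCompact h₂.isCompact).union
    (isCompact_linkedQuads h₂.isCompact h₁.isCompact)).exists_isMinOn hQ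
    (f := fun p : ℝ × ℝ × ℝ × ℝ => (p.2.1 - p.1) + (p.2.2.2 - p.2.2.1)) (by fun_prop)
  rcases hp with hp | hp
  · obtain ⟨q, hq, hlt⟩ := h₁.exists_smaller_linkedQuads h₂ hτ₂ hτ hdisj hp
    exact hlt.not_ge (hmin (Or.inr hq))
  · obtain ⟨q, hq, hlt⟩ := h₂.exists_smaller_linkedQuads h₁ hτ₁ (by linarith) hdisj' hp
    exact hlt.not_ge (hmin (Or.inl hq))

/-! ### Short thick pieces and squared distances -/

theorem IsGap.of_inter_Icc {C : Set ℝ} {v e a b : ℝ} (h : IsGap (C ∩ Icc v e) a b) :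
    IsGap C a b := by
  refine ⟨h.1.1, h.2.1.1, h.2.2.1, fun x hx => ?_⟩
  by_contra! hc
  rcases h.2.2.2 x ⟨hx, h.1.2.1.trans hc.1.le, hc.2.le.trans h.2.1.2.2⟩ with h | h <;> linarith

/-- To the right of a gap `(u, v)` of a thick set there are arbitrarily short thick pieces. -/
theorem IsThick.exists_short_piece {C : Set ℝ} {τ m M u v η : ℝ} (h : IsThick C τ m M)
    (hτ : 0 < τ) (hint : interior C = ∅) (hg : IsGap C u v) (hη : 0 < η) :
    ∃ e, v < e ∧ e ≤ v + η ∧ IsThick (C ∩ Icc v e) τ v e := by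
  -- With this bound `v + η` stays below `M`, and a gap at least as long as `(u, v)` cannot start
  -- within `η` to the right of `v`.
  wlog hη' : η < τ * (v - u) generalizing η
  · obtain ⟨e, he, he', ht⟩ := this (η := min η (τ * (v - u) / 2))
      (lt_min hη (by have := mul_pos hτ (sub_pos.2 hg.2.2.1); linarith))
      ((min_le_right _ _).trans_lt (by have := mul_pos hτ (sub_pos.2 hg.2.2.1); linarith))
    exact ⟨e, he, he'.trans (by linarith [min_le_left η (τ * (v - u) / 2)]), ht⟩
  obtain ⟨-, hv, huv, -⟩ := id hg
  have hvM := h.right_le u v hg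
  have hcl := h.isCompact.isClosed
  have hz : ∃ z ∈ Ioo v (v + η), z ∉ C := by
    by_contra! hc
    have : Ioo v (v + η) ⊆ interior C := isOpen_Ioo.subset_interior_iff.2 hc
    rw [hint] at this
    exact this (show v + η / 2 ∈ _ from ⟨by linarith, by linarith⟩)
  obtain ⟨z, ⟨hvz, hzη⟩, hzC⟩ := hz
  obtain ⟨p₀, q₀, hg₀, hvp₀, hpz₀, hzq₀, -⟩ :=
    exists_isGap hcl hv h.right_mem hzC hvz.le (by linarith)
  -- The piece is cut at the left end of a longest gap `(e, f)` starting in `[v, v + η]`. Gaps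
  -- inside the piece are no longer than `(e, f)`, so their distance to `e` is controlled by `sep`.
  have hPc : IsCompact ({p : ℝ × ℝ | (∀ x ∈ C, x ≤ p.1 ∨ p.2 ≤ x) ∧ v ≤ p.1 ∧ p.1 ≤ v + η} ∩
      C ×ˢ C) := by
    have e1 : IsClosed {p : ℝ × ℝ | v ≤ p.1} := isClosed_le (by fun_prop) (by fun_prop)
    have e2 : IsClosed {p : ℝ × ℝ | p.1 ≤ v + η} := isClosed_le (by fun_prop) (by fun_prop)
    exact (h.isCompact.prod h.isCompact).inter_left ((isClosed_setOf_gap C).inter (e1.inter e2))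
  obtain ⟨⟨e, f⟩, ⟨⟨hef, hve, heη⟩, heC, hfC⟩, hmax⟩ := hPc.exists_isMaxOn
    ⟨(p₀, q₀), ⟨hg₀.2.2.2, hvp₀, by linarith⟩, hg₀.1, hg₀.2.1⟩
    (f := fun p : ℝ × ℝ => p.2 - p.1) (by fun_prop)
  simp only at hef hve heη heC hfC
  have hmax' : ∀ p q, IsGap C p q → v ≤ p → p ≤ v + η → q - p ≤ f - e :=
    fun p q hg h1 h2 => hmax (show (p, q) ∈ _ from ⟨⟨hg.2.2.2, h1, h2⟩, hg.1, hg.2.1⟩)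
  have hef' : e < f := by linarith [hmax' p₀ q₀ hg₀ hvp₀ (by linarith), hg₀.2.2.1]
  have hgef : IsGap C e f := ⟨heC, hfC, hef', hef⟩
  have hve' : v < e := by
    have := h.sep u v e f hg hgef hve
    nlinarith [mul_pos hτ (lt_min (sub_pos.2 huv) (sub_pos.2 hef'))]
  refine ⟨e, hve', heη, h.isCompact.inter_right isClosed_Icc, ⟨hv, le_rfl, hve⟩,
    ⟨heC, hve, le_rfl⟩, inter_subset_right, fun a b hab => ?_, fun a b hab => ?_,
    fun a b c d hab hcd => h.sep a b c d hab.of_inter_Icc hcd.of_inter_Icc⟩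
  · have hs := h.sep u v a b hg hab.of_inter_Icc hab.1.2.1
    rcases le_total (v - u) (b - a) with hc | hc
    · rw [min_eq_left hc] at hs
      linarith [hab.1.2.2]
    · rwa [min_eq_right hc] at hs
  · have hs := h.sep a b e f hab.of_inter_Icc hgef hab.2.1.2.2
    rwa [min_eq_left (hmax' a b hab.of_inter_Icc hab.1.2.1 (hab.1.2.2.trans heη))] at hs

theorem IsThick.exists_thick_sq_of_le {C : Set ℝ} {τ m M u v x₀ ρ : ℝ} (h : IsThick C τ m M)
    (hτ : 0 < τ) (hint : interior C = ∅) (hg : IsGap C u v) (hx₀ : x₀ ≤ u) (hρ : 0 < ρ)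
    (hρ' : ρ < 1) : ∃ K ⊆ C, ∃ v e : ℝ, (v - x₀) ^ 2 < (e - x₀) ^ 2 ∧
      ∀ᶠ x in 𝓝 x₀, IsThick ((fun y => (y - x) ^ 2) '' K) (ρ * τ) ((v - x) ^ 2) ((e - x) ^ 2) := by
  have hpos : 0 < v - x₀ := by linarith [hg.2.2.1]
  -- This `η` gives `ρ * (e - x₀) ≤ ρ * (2 - ρ) * (v - x₀) < v - x₀`: the slopes of the square at
  -- `v` and `e` have ratio above `ρ`, also for `x` near `x₀`.
  obtain ⟨e, hve, heη, ht⟩ := h.exists_short_piece hτ hint hg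
    (η := (1 - ρ) * (v - x₀)) (mul_pos (by linarith) hpos)
  refine ⟨C ∩ Icc v e, inter_subset_left, v, e, by nlinarith, ?_⟩
  have hlt : ρ * (e - x₀) < v - x₀ := by nlinarith
  have e1 : ∀ᶠ x in 𝓝 x₀, ρ * (e - x) < v - x :=
    ContinuousAt.eventually_lt (by fun_prop) (by fun_prop) hlt
  have e2 : ∀ᶠ x in 𝓝 x₀, 0 < v - x :=
    ContinuousAt.eventually_lt (by fun_prop) (by fun_prop) hpos
  filter_upwards [e1, e2] with x h1 h2
  refine ht.image (f := fun y => (y - x) ^ 2) (A := 2 * (v - x)) (B := 2 * (e - x))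
    (by fun_prop) hτ.le hρ.le (by linarith) (by linarith) ?_ ?_
  · rintro y ⟨-, hy⟩ z ⟨-, hz⟩ hyz
    nlinarith [hy.1, hz.1, mul_nonneg (sub_nonneg.2 hyz) (sub_nonneg.2 hy.1),
      mul_nonneg (sub_nonneg.2 hyz) (sub_nonneg.2 hz.1)]
  · rintro y ⟨-, hy⟩ z ⟨-, hz⟩ hyz
    nlinarith [mul_nonneg (sub_nonneg.2 hyz) (sub_nonneg.2 hy.2),
      mul_nonneg (sub_nonneg.2 hyz) (sub_nonneg.2 hz.2)]

theorem IsThick.exists_thick_sq {C : Set ℝ} {τ m M u v x₀ ρ : ℝ} (h : IsThick C τ m M)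
    (hτ : 0 < τ) (hint : interior C = ∅) (hg : IsGap C u v) (hx₀ : x₀ ∈ C) (hρ : 0 < ρ)
    (hρ' : ρ < 1) : ∃ K ⊆ C, ∃ v e : ℝ, (v - x₀) ^ 2 < (e - x₀) ^ 2 ∧
      ∀ᶠ x in 𝓝 x₀, IsThick ((fun y => (y - x) ^ 2) '' K) (ρ * τ) ((v - x) ^ 2) ((e - x) ^ 2) := by
  rcases hg.2.2.2 x₀ hx₀ with hu | hv
  · exact h.exists_thick_sq_of_le hτ hint hg hu hρ hρ'
  · have hint' : interior (Homeomorph.neg ℝ ⁻¹' C) = ∅ := by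
      rw [← Homeomorph.preimage_interior, hint, preimage_empty]
    obtain ⟨K, hK, v', e, hlt, hev⟩ :=
      h.neg.exists_thick_sq_of_le hτ hint' hg.neg (neg_le_neg hv) hρ hρ'
    refine ⟨-K, by simpa using neg_subset_neg.2 hK, -v', -e, by nlinarith, ?_⟩
    filter_upwards [(continuous_neg.tendsto x₀).eventually hev] with x hx
    have e1 : ∀ y : ℝ, (-y - x) ^ 2 = (y - -x) ^ 2 := fun y => by ring
    rw [e1, e1]
    convert hx using 1
    rw [← image_neg_eq_neg, image_image]
    simp only [e1]

/-- For `x` near a point `x₀` of a product of thick sets of reals, the squared distances from `x`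
to the product fill a fixed neighborhood of some `s₀ > 0`. -/
theorem IsThick.eventually_exists_sq_add_sq {C₁ C₂ : Set ℝ}
    {τ₁ τ₂ m₁ M₁ m₂ M₂ u₁ v₁ u₂ v₂ x₁ x₂ : ℝ}
    (h₁ : IsThick C₁ τ₁ m₁ M₁) (h₂ : IsThick C₂ τ₂ m₂ M₂) (hτ₁ : 0 < τ₁) (hτ₂ : 0 < τ₂)
    (hτ : 1 < τ₁ * τ₂) (hint₁ : interior C₁ = ∅) (hint₂ : interior C₂ = ∅)
    (hg₁ : IsGap C₁ u₁ v₁) (hg₂ : IsGap C₂ u₂ v₂) (hx₁ : x₁ ∈ C₁) (hx₂ : x₂ ∈ C₂) :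
    ∃ s₀ : ℝ, 0 < s₀ ∧ ∀ᶠ p : (ℝ × ℝ) × ℝ in 𝓝 ((x₁, x₂), s₀),
      ∃ y₁ ∈ C₁, ∃ y₂ ∈ C₂, (y₁ - p.1.1) ^ 2 + (y₂ - p.1.2) ^ 2 = p.2 := by
  obtain ⟨ρ, hρ, hρ1, hρτ⟩ : ∃ ρ : ℝ, 0 < ρ ∧ ρ < 1 ∧ 1 < (ρ * τ₁) * (ρ * τ₂) := by
    have : ∀ᶠ ρ : ℝ in 𝓝[<] 1, 1 < (ρ * τ₁) * (ρ * τ₂) :=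
      nhdsWithin_le_nhds (ContinuousAt.eventually_lt (by fun_prop) (by fun_prop) (by linarith))
    obtain ⟨ρ, h1, h2⟩ := (this.and (Ioo_mem_nhdsLT (zero_lt_one' ℝ))).exists
    exact ⟨ρ, h2.1, h2.2, h1⟩
  obtain ⟨K₁, hK₁, a, b, hab, hev₁⟩ := h₁.exists_thick_sq hτ₁ hint₁ hg₁ hx₁ hρ hρ1
  obtain ⟨K₂, hK₂, c, d, hcd, hev₂⟩ := h₂.exists_thick_sq hτ₂ hint₂ hg₂ hx₂ hρ hρ1
  -- These bounds say that the hulls of `(K₁ - x₁) ^ 2` and `s₀ - (K₂ - x₂) ^ 2` overlap, with the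
  -- first one further left at both ends. They are open conditions, so they persist near `s₀` and
  -- the pins.
  obtain ⟨s₀, hs, hs'⟩ : ∃ s₀, max ((a - x₁) ^ 2 + (d - x₂) ^ 2) ((b - x₁) ^ 2 + (c - x₂) ^ 2) < s₀ ∧
      s₀ < (b - x₁) ^ 2 + (d - x₂) ^ 2 := exists_between (max_lt (by linarith) (by linarith))
  rw [max_lt_iff] at hs
  refine ⟨s₀, lt_of_le_of_lt (by positivity) hs.1, ?_⟩
  have c1 : Tendsto (fun p : (ℝ × ℝ) × ℝ => p.1.1) (𝓝 ((x₁, x₂), s₀)) (𝓝 x₁) :=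
    (continuous_fst.comp continuous_fst).tendsto _
  have c2 : Tendsto (fun p : (ℝ × ℝ) × ℝ => p.1.2) (𝓝 ((x₁, x₂), s₀)) (𝓝 x₂) :=
    (continuous_snd.comp continuous_fst).tendsto _
  have e1 : ∀ᶠ p : (ℝ × ℝ) × ℝ in 𝓝 ((x₁, x₂), s₀), (a - p.1.1) ^ 2 + (d - p.1.2) ^ 2 < p.2 :=
    ContinuousAt.eventually_lt (by fun_prop) (by fun_prop) hs.1
  have e2 : ∀ᶠ p : (ℝ × ℝ) × ℝ in 𝓝 ((x₁, x₂), s₀), (b - p.1.1) ^ 2 + (c - p.1.2) ^ 2 < p.2 :=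
    ContinuousAt.eventually_lt (by fun_prop) (by fun_prop) hs.2
  have e3 : ∀ᶠ p : (ℝ × ℝ) × ℝ in 𝓝 ((x₁, x₂), s₀), p.2 < (b - p.1.1) ^ 2 + (d - p.1.2) ^ 2 :=
    ContinuousAt.eventually_lt (by fun_prop) (by fun_prop) hs'
  filter_upwards [c1.eventually hev₁, c2.eventually hev₂, e1, e2, e3] with p t1 t2 l1 l2 l3
  have t3 : IsThick ((fun y => y + p.2) '' (-((fun y => (y - p.1.2) ^ 2) '' K₂))) (1 * (ρ * τ₂))
      (-(d - p.1.2) ^ 2 + p.2) (-(c - p.1.2) ^ 2 + p.2) :=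
    t2.neg.image (f := fun y => y + p.2) (A := 1) (B := 1) (by fun_prop) (by positivity)
      zero_le_one one_pos (by norm_num) (fun x _ y _ _ => by linarith) (fun x _ y _ _ => by linarith)
  obtain ⟨_, ⟨y₁, hy₁, rfl⟩, w, ⟨y₂, hy₂, hw⟩, hy⟩ := t1.inter_nonempty t3 (by positivity)
    (by positivity) (by simpa using hρτ) (by linarith) (by linarith) (by linarith)
  refine ⟨y₁, hK₁ hy₁, y₂, hK₂ hy₂, ?_⟩
  simp only at hw hy
  linarith

/-! ### Separation of gaps and reduction to one factor -/

section ThicknessBounds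

variable {d : ℕ}

/-- This frees the thickness from the listing: of two gaps, the later one in the list has the
smaller diameter and is the one compared with the other. -/
theorem mul_diam_le_of_lt_thickness (hd : 1 ≤ d) {C : Set (Rd d)} (hC : IsCompact C)
    (hne : (boundedGaps C).Nonempty) {τ : ℝ} (hτ : 0 ≤ τ) (h : ENNReal.ofReal τ < thickness C) :
    (∀ G ∈ boundedGaps C, ∀ g ∈ G, ∀ e ∈ unboundedGap C, τ * Metric.diam G ≤ dist g e) ∧
      ∀ G ∈ boundedGaps C, ∀ G' ∈ boundedGaps C, G ≠ G' → ∀ g ∈ G, ∀ g' ∈ G',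
        τ * min (Metric.diam G) (Metric.diam G') ≤ dist g g' := by
  rw [thickness, if_pos hne] at h
  simp only [lt_iSup_iff] at h
  obtain ⟨N, G, hG, hlt⟩ := h
  have key : ∀ n : ℕ, (n : ℕ∞) < N → ∀ g ∈ G n,
      ∀ b ∈ (⋃ (i : ℕ) (_ : i < n), G i) ∪ unboundedGap C, τ * Metric.diam (G n) ≤ dist g b := by
    intro n hn g hg b hb
    have hGn := hG.bijOn.mapsTo hn
    obtain ⟨h0, ht⟩ := ediam_boundedGap_ne hd hC hGn
    have h1 : ENNReal.ofReal τ * Metric.ediam (G n) ≤ edist g b := by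
      refine le_trans ?_ (show setEDist (G n) _ ≤ edist g b from
        iInf₂_le_of_le g hg (iInf₂_le b hb))
      rw [← ENNReal.le_div_iff_mul_le (Or.inl h0) (Or.inl ht)]
      exact hlt.le.trans (iInf₂_le n hn)
    rw [Metric.diam, dist_edist, ← ENNReal.toReal_ofReal hτ, ← ENNReal.toReal_mul]
    exact ENNReal.toReal_mono (edist_ne_top _ _) h1
  have hmono : ∀ m n : ℕ, m ≤ n → (n : ℕ∞) < N → Metric.diam (G n) ≤ Metric.diam (G m) := by
    intro m n hmn hn
    have hm : (m : ℕ∞) < N := lt_of_le_of_lt (by exact_mod_cast hmn) hn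
    exact ENNReal.toReal_mono (ediam_boundedGap_ne hd hC (hG.bijOn.mapsTo hm)).2
      (hG.antitone m n hmn hn)
  constructor
  · intro A hA g hg e he
    obtain ⟨n, hn, rfl⟩ := hG.bijOn.surjOn hA
    exact key n hn g hg e (Or.inr he)
  · intro A hA B hB hAB g hg g' hg'
    obtain ⟨n, hn, rfl⟩ := hG.bijOn.surjOn hA
    obtain ⟨m, hm, rfl⟩ := hG.bijOn.surjOn hB
    have hnm : n ≠ m := fun h => hAB (h ▸ rfl)
    rcases hnm.lt_or_gt with hlt | hlt
    · rw [min_eq_right (hmono n m hlt.le hm), dist_comm]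
      exact key m hm g' hg' g (Or.inl (mem_iUnion₂.2 ⟨n, hlt, hg⟩))
    · rw [min_eq_left (hmono m n hlt.le hn)]
      exact key n hn g hg g' (Or.inl (mem_iUnion₂.2 ⟨m, hlt, hg'⟩))

theorem boundedGaps_nonempty_of_thickness_pos {C : Set (Rd d)} (hint : interior C = ∅)
    (h : 0 < thickness C) : (boundedGaps C).Nonempty := by
  by_contra hne
  rw [thickness, if_neg hne, if_neg (by simp [hint])] at h
  exact h.false

theorem exists_interior_inter_pinnedDist {A : Set (R2d d)} {x₀ : R2d d} {t₀ : ℝ}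
    (h : ∀ᶠ p : R2d d × ℝ in 𝓝 (x₀, t₀), ∃ y ∈ A, p.2 = ‖p.1 - y‖) :
    ∃ S : Set (R2d d), IsOpen S ∧ x₀ ∈ S ∧ (interior (⋂ x ∈ S, pinnedDist x A)).Nonempty := by
  obtain ⟨S, T, hS, hxS, hT, htT, hsub⟩ := mem_nhds_prod_iff'.1 h
  refine ⟨S, hS, hxS, t₀, hT.subset_interior_iff.2 (fun t ht => ?_) htT⟩
  exact mem_iInter₂.2 fun x hx => hsub (show (x, t) ∈ S ×ˢ T from ⟨hx, ht⟩)

theorem tendsto_sqrt_sq_sub {X E : Type*} [TopologicalSpace X] [SeminormedAddCommGroup E]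
    {f : X → E} {z : E} {x₀ : X} {r₀ : ℝ} (hf : ContinuousAt f x₀) (hz : f x₀ = z) (hr : 0 < r₀) :
    Tendsto (fun p : X × ℝ => √(p.2 ^ 2 - ‖f p.1 - z‖ ^ 2)) (𝓝 (x₀, r₀)) (𝓝 r₀) := by
  have hf' : ContinuousAt (fun p : X × ℝ => f p.1) (x₀, r₀) :=
    ContinuousAt.comp (f := Prod.fst) hf continuousAt_fst
  have : ContinuousAt (fun p : X × ℝ => √(p.2 ^ 2 - ‖f p.1 - z‖ ^ 2)) (x₀, r₀) :=
    ((continuousAt_snd.pow 2).sub ((hf'.sub continuousAt_const).norm.pow 2)).sqrt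
  simpa [ContinuousAt, hz, Real.sqrt_sq hr.le] using this

theorem eq_norm_sub_toLp (x : R2d d) (y₁ y₂ : Rd d) {t : ℝ} (ht : 0 ≤ t)
    (h : ‖x.fst - y₁‖ ^ 2 + ‖x.snd - y₂‖ ^ 2 = t ^ 2) : t = ‖x - WithLp.toLp 2 (y₁, y₂)‖ := by
  rw [WithLp.prod_norm_eq_of_L2]
  exact (Real.sqrt_sq ht).symm.trans (congrArg _ h.symm)

/-- With the second coordinate of `y` frozen at `x₀.snd`, the first must lie at distance `√(t ^ 2 -
‖x.snd - x₀.snd‖ ^ 2)`, which tends to `r₀`. -/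
theorem eventually_exists_prodSet_of_fst {C₁ C₂ : Set (Rd d)} {x₀ : R2d d} {r₀ : ℝ} (hr₀ : 0 < r₀)
    (hx₀ : x₀.snd ∈ C₂) (h : ∀ᶠ p : Rd d × ℝ in 𝓝 (x₀.fst, r₀), ∃ y ∈ C₁, ‖p.1 - y‖ = p.2) :
    ∀ᶠ p : R2d d × ℝ in 𝓝 (x₀, r₀), ∃ y ∈ prodSet C₁ C₂, p.2 = ‖p.1 - y‖ := by
  have ht := tendsto_sqrt_sq_sub (f := fun x : R2d d => x.snd) (x₀ := x₀) (r₀ := r₀)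
    (by fun_prop) rfl hr₀
  have hx : Tendsto (fun p : R2d d × ℝ => p.1.fst) (𝓝 (x₀, r₀)) (𝓝 x₀.fst) :=
    (show Continuous (fun p : R2d d × ℝ => p.1.fst) by fun_prop).tendsto _
  have hs : Tendsto (fun p : R2d d × ℝ => p.2) (𝓝 (x₀, r₀)) (𝓝 r₀) :=
    continuous_snd.tendsto (x₀, r₀)
  filter_upwards [(hx.prodMk_nhds ht).eventually h, hs.eventually (lt_mem_nhds hr₀),
    ht.eventually (lt_mem_nhds hr₀)] with p ⟨y, hy, hp⟩ hp2 hpos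
  refine ⟨WithLp.toLp 2 (y, x₀.snd), ⟨hy, hx₀⟩, ?_⟩
  refine eq_norm_sub_toLp _ _ _ (le_of_lt hp2) ?_
  rw [hp, Real.sq_sqrt (Real.sqrt_pos.1 hpos).le]
  ring

theorem eventually_exists_prodSet_of_snd {C₁ C₂ : Set (Rd d)} {x₀ : R2d d} {r₀ : ℝ} (hr₀ : 0 < r₀)
    (hx₀ : x₀.fst ∈ C₁) (h : ∀ᶠ p : Rd d × ℝ in 𝓝 (x₀.snd, r₀), ∃ y ∈ C₂, ‖p.1 - y‖ = p.2) :
    ∀ᶠ p : R2d d × ℝ in 𝓝 (x₀, r₀), ∃ y ∈ prodSet C₁ C₂, p.2 = ‖p.1 - y‖ := by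
  have ht := tendsto_sqrt_sq_sub (f := fun x : R2d d => x.fst) (x₀ := x₀) (r₀ := r₀)
    (by fun_prop) rfl hr₀
  have hx : Tendsto (fun p : R2d d × ℝ => p.1.snd) (𝓝 (x₀, r₀)) (𝓝 x₀.snd) :=
    (show Continuous (fun p : R2d d × ℝ => p.1.snd) by fun_prop).tendsto _
  have hs : Tendsto (fun p : R2d d × ℝ => p.2) (𝓝 (x₀, r₀)) (𝓝 r₀) :=
    continuous_snd.tendsto (x₀, r₀)
  filter_upwards [(hx.prodMk_nhds ht).eventually h, hs.eventually (lt_mem_nhds hr₀),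
    ht.eventually (lt_mem_nhds hr₀)] with p ⟨y, hy, hp⟩ hp2 hpos
  refine ⟨WithLp.toLp 2 (x₀.fst, y), ⟨hx₀, hy⟩, ?_⟩
  refine eq_norm_sub_toLp _ _ _ (le_of_lt hp2) ?_
  rw [hp, Real.sq_sqrt (Real.sqrt_pos.1 hpos).le]
  ring

/-! ### Radii filled by a single factor -/

/-- The point at distance `r` from `x` in the direction of `q - x₀` tends to `q` as
`(x, r) → (x₀, ‖q - x₀‖)`. -/
theorem tendsto_add_smul_sub {q x₀ : Rd d} (h : q ≠ x₀) :
    Tendsto (fun p : Rd d × ℝ => p.1 + (p.2 / ‖q - x₀‖) • (q - x₀)) (𝓝 (x₀, ‖q - x₀‖)) (𝓝 q) := by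
  have h0 : ‖q - x₀‖ ≠ 0 := norm_ne_zero_iff.2 (sub_ne_zero.2 h)
  have : Continuous (fun p : Rd d × ℝ => p.1 + (p.2 / ‖q - x₀‖) • (q - x₀)) := by fun_prop
  simpa [div_self h0] using this.tendsto (x₀, ‖q - x₀‖)

theorem norm_div_norm_smul {v : Rd d} (h : v ≠ 0) {r : ℝ} (hr : 0 ≤ r) : ‖(r / ‖v‖) • v‖ = r := by
  have h0 : ‖v‖ ≠ 0 := norm_ne_zero_iff.2 h
  rw [norm_smul, Real.norm_of_nonneg (by positivity), div_mul_cancel₀ _ h0]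

theorem exists_radius_of_interior_nonempty (hd : 1 ≤ d) {C : Set (Rd d)}
    (hint : (interior C).Nonempty) (x₀ : Rd d) :
    ∃ r₀ : ℝ, 0 < r₀ ∧ ∀ᶠ p : Rd d × ℝ in 𝓝 (x₀, r₀), ∃ y ∈ C, ‖p.1 - y‖ = p.2 := by
  have : NeZero d := ⟨by omega⟩
  obtain ⟨q, hqC, hq⟩ := (dense_compl_singleton x₀).inter_open_nonempty _ isOpen_interior hint
  have hq : q ≠ x₀ := hq
  have h0 : 0 < ‖q - x₀‖ := norm_pos_iff.2 (sub_ne_zero.2 hq)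
  refine ⟨‖q - x₀‖, h0, ?_⟩
  filter_upwards [(tendsto_add_smul_sub hq).eventually (mem_interior_iff_mem_nhds.1 hqC),
    (continuous_snd.tendsto (x₀, ‖q - x₀‖)).eventually (lt_mem_nhds h0)] with p hp hp2
  refine ⟨_, hp, ?_⟩
  rw [sub_add_cancel_left, norm_neg, norm_div_norm_smul (sub_ne_zero.2 hq) hp2.le]

/-- A gap of small diameter, compared with its distance to `x₀`, does not contain spheres
around `x₀`. -/
theorem exists_radius_of_small_gap (hd : 2 ≤ d) {C : Set (Rd d)} (hC : IsCompact C)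
    {x₀ q : Rd d} (hqC : q ∉ C) (hb : Bornology.IsBounded (pathComponentIn Cᶜ q))
    (hq : q ≠ x₀) (hdiam : Metric.diam (pathComponentIn Cᶜ q) < 2 * ‖q - x₀‖) :
    ∀ᶠ p : Rd d × ℝ in 𝓝 (x₀, ‖q - x₀‖), ∃ y ∈ C, ‖p.1 - y‖ = p.2 := by
  have h0 : 0 < ‖q - x₀‖ := norm_pos_iff.2 (sub_ne_zero.2 hq)
  have hv : q - x₀ ≠ 0 := sub_ne_zero.2 hq
  have ho : pathComponentIn Cᶜ q ∈ 𝓝 q :=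
    (hC.isClosed.isOpen_compl.pathComponentIn q).mem_nhds (mem_pathComponentIn_self hqC)
  have e1 : ∀ᶠ p : Rd d × ℝ in 𝓝 (x₀, ‖q - x₀‖), Metric.diam (pathComponentIn Cᶜ q) < 2 * p.2 :=
    ContinuousAt.eventually_lt (by fun_prop) (by fun_prop) hdiam
  filter_upwards [(tendsto_add_smul_sub hq).eventually ho, e1,
    (continuous_snd.tendsto (x₀, ‖q - x₀‖)).eventually (lt_mem_nhds h0)] with p hp hp1 hp2
  have hp2 : 0 < p.2 := hp2
  have hrank : 1 < Module.rank ℝ (Rd d) := by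
    rw [← Module.finrank_eq_rank, finrank_euclideanSpace_fin]
    exact_mod_cast hd
  set v := (p.2 / ‖q - x₀‖) • (q - x₀) with hvdef
  have hvn : ‖v‖ = p.2 := norm_div_norm_smul hv hp2.le
  by_contra! hc
  have hsub : Metric.sphere p.1 p.2 ⊆ Cᶜ := fun y hy hyC =>
    hc y hyC (by rw [← dist_eq_norm, dist_comm]; exact hy)
  have hsub' := (isPathConnected_sphere hrank p.1 hp2.le).subset_pathComponentIn
    (x := p.1 + v) (by simp [hvn]) hsub
  rw [pathComponentIn_congr hp] at hsub'
  -- The antipodal points `p.1 + v` and `p.1 - v` would both lie in the gap, at distance `2 * p.2`,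
  -- more than its diameter.
  have hm : p.1 - v ∈ pathComponentIn Cᶜ q := hsub' (by simp [hvn])
  have := Metric.dist_le_diam_of_mem hb hp hm
  rw [dist_eq_norm, show p.1 + v - (p.1 - v) = (2 : ℝ) • v by rw [two_smul]; abel, norm_smul,
    hvn, Real.norm_two] at this
  linarith

/-- Just beyond the last exit from the closure of a gap `G`, along a ray from `x₀`, empty interior
provides a point `q` of another component of the complement. Its closeness to `G` forces this
component to be bounded and small, while `q` stays away from `x₀`. -/
theorem exists_radius_of_thickness_pos (hd : 2 ≤ d) {C : Set (Rd d)} (hC : IsCompact C)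
    (hint : interior C = ∅) (hτ : 0 < thickness C) {x₀ : Rd d} (hx₀ : x₀ ∈ C) :
    ∃ r₀ : ℝ, 0 < r₀ ∧ ∀ᶠ p : Rd d × ℝ in 𝓝 (x₀, r₀), ∃ y ∈ C, ‖p.1 - y‖ = p.2 := by
  have hd1 : 1 ≤ d := by omega
  have hne := boundedGaps_nonempty_of_thickness_pos hint hτ
  obtain ⟨t, ht0, ht⟩ : ∃ t : ℝ, 0 < t ∧ ENNReal.ofReal t < thickness C := by
    obtain ⟨r, hr0, hr⟩ := exists_between hτ
    have hrt : r ≠ ⊤ := hr.ne_top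
    exact ⟨r.toReal, ENNReal.toReal_pos hr0.ne' hrt, by rwa [ENNReal.ofReal_toReal hrt]⟩
  obtain ⟨hE, hsep⟩ := mul_diam_le_of_lt_thickness hd1 hC hne ht0.le ht
  obtain ⟨G, hG⟩ := hne
  have hdG : 0 < Metric.diam G :=
    ENNReal.toReal_pos (ediam_boundedGap_ne hd1 hC hG).1 (ediam_boundedGap_ne hd1 hC hG).2
  obtain ⟨⟨g, hgC, hGg⟩, hGb⟩ := id hG
  have hgG : g ∈ G := hGg ▸ mem_pathComponentIn_self hgC
  have hgx : g - x₀ ≠ 0 := sub_ne_zero.2 (by rintro rfl; exact hgC hx₀)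
  have hn : 0 < ‖g - x₀‖ := norm_pos_iff.2 hgx
  set ray : ℝ → Rd d := fun s => x₀ + (1 + s) • (g - x₀) with hray
  have hrayc : Continuous ray := by fun_prop
  have hdist : ∀ s s', dist (ray s) (ray s') = |s - s'| * ‖g - x₀‖ := fun s s' => by
    rw [dist_eq_norm, ← Real.norm_eq_abs, ← norm_smul]
    congr 1
    simp only [hray]
    module
  have hT : IsCompact {s : ℝ | 0 ≤ s ∧ ray s ∈ closure G} := by
    refine Metric.isCompact_of_isClosed_isBounded
      ((isClosed_Ici (a := (0:ℝ))).inter (isClosed_closure.preimage hrayc)) ?_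
    refine Metric.isBounded_iff.2 ⟨Metric.diam (closure G) / ‖g - x₀‖, fun s hs s' hs' => ?_⟩
    rw [le_div_iff₀ hn, Real.dist_eq, ← hdist]
    exact Metric.dist_le_diam_of_mem hGb.closure hs.2 hs'.2
  obtain ⟨s, ⟨hs0, hsG⟩, hsmax⟩ := hT.exists_isGreatest
    ⟨0, le_rfl, subset_closure (by simpa [hray] using hgG)⟩
  -- The first bound excludes the unbounded gap and gaps at least as wide as `G` within `2 * ε` of
  -- `G`; the second makes the remaining gap narrower than `‖q - x₀‖`.
  obtain ⟨ε, hε0, hε1, hε2⟩ : ∃ ε : ℝ, 0 < ε ∧ 2 * ε < t * Metric.diam G ∧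
      2 * ε < t * (‖g - x₀‖ - ε) := by
    have e1 : ∀ᶠ ε : ℝ in 𝓝[>] 0, 2 * ε < t * Metric.diam G :=
      nhdsWithin_le_nhds (ContinuousAt.eventually_lt (by fun_prop) (by fun_prop) (by
        simpa using mul_pos ht0 hdG))
    have e2 : ∀ᶠ ε : ℝ in 𝓝[>] 0, 2 * ε < t * (‖g - x₀‖ - ε) :=
      nhdsWithin_le_nhds (ContinuousAt.eventually_lt (by fun_prop) (by fun_prop) (by
        simpa using mul_pos ht0 hn))
    obtain ⟨ε, ⟨h1, h2⟩, h3⟩ := ((e1.and e2).and self_mem_nhdsWithin).exists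
    exact ⟨ε, h3, h1, h2⟩
  have hV : IsOpen (Metric.ball (ray s) ε ∩ (closure G)ᶜ) :=
    Metric.isOpen_ball.inter isClosed_closure.isOpen_compl
  obtain ⟨q, ⟨hqε, hqG⟩, hqC⟩ : ∃ q ∈ Metric.ball (ray s) ε ∩ (closure G)ᶜ, q ∉ C := by
    by_contra! hc
    have h1 := hV.subset_interior_iff.2 hc
    rw [hint] at h1
    have hδ : 0 < ε / 2 / ‖g - x₀‖ := by positivity
    refine h1 (a := ray (s + ε / 2 / ‖g - x₀‖)) ⟨?_, fun hcl => ?_⟩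
    · rw [Metric.mem_ball, hdist, add_sub_cancel_left, abs_of_pos hδ, div_mul_cancel₀ _ hn.ne']
      linarith
    · have := hsmax ⟨by linarith, hcl⟩
      linarith
  obtain ⟨g', hg'G, hg'ε⟩ := Metric.mem_closure_iff.1 hsG ε hε0
  have hg'q : dist g' q < 2 * ε := by
    have := dist_triangle g' (ray s) q
    rw [dist_comm g' (ray s), dist_comm (ray s) q] at this
    have := Metric.mem_ball.1 hqε
    linarith
  have hqself : q ∈ pathComponentIn Cᶜ q := mem_pathComponentIn_self hqC
  have hb : Bornology.IsBounded (pathComponentIn Cᶜ q) := by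
    by_contra hb
    have := hE G hG g' hg'G q ⟨_, ⟨⟨q, hqC, rfl⟩, hb⟩, hqself⟩
    linarith
  have hsep' := hsep G hG _ ⟨⟨q, hqC, rfl⟩, hb⟩
    (by rintro h; exact hqG (subset_closure (h ▸ hqself))) g' hg'G q hqself
  have hdiam : t * Metric.diam (pathComponentIn Cᶜ q) < 2 * ε := by
    rcases le_total (Metric.diam G) (Metric.diam (pathComponentIn Cᶜ q)) with h | h
    · rw [min_eq_left h] at hsep'
      linarith
    · rw [min_eq_right h] at hsep'
      linarith
  have hqn : ‖g - x₀‖ - ε < ‖q - x₀‖ := by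
    have h1 := dist_triangle (ray s) q x₀
    rw [dist_comm (ray s) q, dist_eq_norm q x₀] at h1
    have h2 : ‖g - x₀‖ ≤ dist (ray s) x₀ := by
      rw [dist_eq_norm, hray, add_sub_cancel_left, norm_smul, Real.norm_of_nonneg (by linarith)]
      nlinarith
    have := Metric.mem_ball.1 hqε
    linarith
  have hpos : 0 < ‖g - x₀‖ - ε := pos_of_mul_pos_right (by linarith) ht0.le
  refine ⟨‖q - x₀‖, by linarith, exists_radius_of_small_gap hd hC hqC hb
    (sub_ne_zero.1 (norm_pos_iff.1 (by linarith))) ?_⟩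
  have := lt_of_mul_lt_mul_left (hdiam.trans hε2) ht0.le
  linarith

end ThicknessBounds

/-! ### Dimension one -/

section Line

/-- The isometry between the real line and `ℝ^1`. -/
noncomputable def lineIso : ℝ ≃ᵢ Rd 1 where
  toFun s := EuclideanSpace.single 0 s
  invFun x := x 0
  left_inv s := by simp
  right_inv x := by
    ext i
    fin_cases i
    simp
  isometry_toFun := Isometry.of_dist_eq fun s t => PiLp.dist_single_same _ _ _ _ _

theorem image_lineIso_mem_boundedGaps {C : Set (Rd 1)} {a b : ℝ} (h : IsGap (lineIso ⁻¹' C) a b) :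
    lineIso '' Ioo a b ∈ boundedGaps C := by
  obtain ⟨ha, hb, hab, hg⟩ := h
  have hmid : (a + b) / 2 ∈ Ioo a b := ⟨by linarith, by linarith⟩
  have hsub : lineIso '' Ioo a b ⊆ Cᶜ := by
    rintro _ ⟨x, hx, rfl⟩ hxC
    rcases hg x hxC with h | h
    · exact absurd hx.1 h.not_gt
    · exact absurd hx.2 h.not_gt
  have hmC : lineIso ((a + b) / 2) ∈ Cᶜ := hsub ⟨_, hmid, rfl⟩
  refine ⟨⟨lineIso ((a + b) / 2), hmC, ?_⟩,
    lineIso.isometry.lipschitz.isBounded_image (Metric.isBounded_Ioo a b)⟩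
  refine Subset.antisymm ((((convex_Ioo a b).isPathConnected ⟨_, hmid⟩).image
    lineIso.continuous).subset_pathComponentIn ⟨_, hmid, rfl⟩ hsub) fun y hy => ?_
  -- On the line the component is an interval; it contains the midpoint and avoids `a` and `b`.
  have hpc := ((isPathConnected_pathComponentIn hmC).image lineIso.symm.continuous).isConnected
  have hord := hpc.isPreconnected.ordConnected
  have hm1 : (a + b) / 2 ∈ lineIso.symm '' pathComponentIn Cᶜ (lineIso ((a + b) / 2)) :=
    ⟨_, mem_pathComponentIn_self hmC, by simp⟩
  have hm2 : lineIso.symm y ∈ lineIso.symm '' pathComponentIn Cᶜ (lineIso ((a + b) / 2)) := ⟨y, hy, rfl⟩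
  have hnot : ∀ z, lineIso z ∈ C → z ∉ lineIso.symm '' pathComponentIn Cᶜ (lineIso ((a + b) / 2)) := by
    rintro _ hz ⟨w, hw, rfl⟩
    rw [IsometryEquiv.apply_symm_apply] at hz
    exact pathComponentIn_subset hw hz
  refine ⟨lineIso.symm y, ⟨?_, ?_⟩, by simp⟩
  · by_contra! hc
    exact hnot a ha (hord.out hm2 hm1 ⟨hc, hmid.1.le⟩)
  · by_contra! hc
    exact hnot b hb (hord.out hm1 hm2 ⟨hmid.2.le, hc⟩)

theorem diam_image_lineIso_Ioo {a b : ℝ} (h : a ≤ b) : Metric.diam (lineIso '' Ioo a b) = b - a := by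
  rw [lineIso.isometry.diam_image, Real.diam_Ioo h]

theorem not_isBounded_pathComponentIn {C : Set (Rd 1)} {m M s : ℝ} (hC : lineIso ⁻¹' C ⊆ Icc m M)
    (hs : s < m ∨ M < s) : ¬ Bornology.IsBounded (pathComponentIn Cᶜ (lineIso s)) := by
  obtain ⟨U, hU, hUb, hsU, hUC⟩ : ∃ U : Set ℝ, Convex ℝ U ∧ ¬ Bornology.IsBounded U ∧ s ∈ U ∧
      ∀ x ∈ U, lineIso x ∉ C := by
    rcases hs with hs | hs
    · exact ⟨Iio m, convex_Iio m, fun h => not_bddBelow_Iio m h.bddBelow, hs,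
        fun x hx hxC => (hC hxC).1.not_gt hx⟩
    · exact ⟨Ioi M, convex_Ioi M, fun h => not_bddAbove_Ioi M h.bddAbove, hs,
        fun x hx hxC => (hC hxC).2.not_gt hx⟩
  intro hb
  have hsub := ((hU.isPathConnected ⟨s, hsU⟩).image lineIso.continuous).subset_pathComponentIn
    ⟨s, hsU, rfl⟩ (show lineIso '' U ⊆ Cᶜ by rintro _ ⟨x, hx, rfl⟩; exact hUC x hx)
  exact hUb ((lineIso.isometry.antilipschitz.isBounded_preimage (hb.subset hsub)).subset
    (subset_preimage_image _ _))

theorem mem_unboundedGap_of_line {C : Set (Rd 1)} {m M s : ℝ} (hC : lineIso ⁻¹' C ⊆ Icc m M)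
    (hs : s < m ∨ M < s) : lineIso s ∈ unboundedGap C := by
  have hsC : lineIso s ∈ Cᶜ := fun h => by
    rcases hs with hs | hs
    · exact (hC h).1.not_gt hs
    · exact (hC h).2.not_gt hs
  exact ⟨_, ⟨⟨lineIso s, hsC, rfl⟩, not_isBounded_pathComponentIn hC hs⟩, mem_pathComponentIn_self hsC⟩

theorem exists_isThick_of_lt_thickness {C : Set (Rd 1)} (hC : IsCompact C) (hint : interior C = ∅)
    {τ : ℝ} (hτ : 0 < τ) (h : ENNReal.ofReal τ < thickness C) :
    (∃ m M, IsThick (lineIso ⁻¹' C) τ m M) ∧ ∃ u v, IsGap (lineIso ⁻¹' C) u v := by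
  have hne := boundedGaps_nonempty_of_thickness_pos hint (pos_of_gt h)
  obtain ⟨hE, hsep⟩ := mul_diam_le_of_lt_thickness le_rfl hC hne hτ.le h
  have hK : IsCompact (lineIso ⁻¹' C) := lineIso.toHomeomorph.isCompact_preimage.2 hC
  have hKne : (lineIso ⁻¹' C).Nonempty := by
    by_contra hK0
    obtain ⟨G, ⟨⟨x, hx, rfl⟩, hb⟩⟩ := hne
    rw [← lineIso.apply_symm_apply x] at hb
    -- For empty `C` the inclusion in `Icc m M` is vacuous; any `m` beyond the point will do.
    refine not_isBounded_pathComponentIn (m := lineIso.symm x + 1) (M := 0) ?_ (Or.inl (by linarith)) hb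
    rw [not_nonempty_iff_eq_empty.1 hK0]
    exact empty_subset _
  obtain ⟨m, hm, hm'⟩ := hK.exists_isLeast hKne
  obtain ⟨M, hM, hM'⟩ := hK.exists_isGreatest hKne
  have hsub : lineIso ⁻¹' C ⊆ Icc m M := fun x hx => ⟨hm' hx, hM' hx⟩
  refine ⟨⟨m, M, hK, hm, hM, hsub, ?_, ?_, ?_⟩, ?_⟩
  · intro a b hg
    have hG := hE _ (image_lineIso_mem_boundedGaps hg)
    rw [diam_image_lineIso_Ioo hg.2.2.1.le] at hG
    refine le_of_forall_pos_le_add fun ε hε => ?_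
    have hab := hg.2.2.1
    -- Gaps are open, so endpoint distances are approached from inside; the cap `(b - a) / 2` keeps
    -- the test point in the gap.
    have hpos : 0 < min (ε / 2) ((b - a) / 2) := lt_min (by linarith) (by linarith)
    have := hG _ ⟨a + min (ε / 2) ((b - a) / 2),
      ⟨by linarith, by linarith [min_le_right (ε / 2) ((b - a) / 2)]⟩, rfl⟩ _
      (mem_unboundedGap_of_line hsub (s := m - ε / 2) (Or.inl (by linarith)))
    rw [lineIso.isometry.dist_eq, Real.dist_eq, abs_of_pos (by linarith [hm' hg.1])] at this
    linarith [min_le_left (ε / 2) ((b - a) / 2)]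
  · intro a b hg
    have hG := hE _ (image_lineIso_mem_boundedGaps hg)
    rw [diam_image_lineIso_Ioo hg.2.2.1.le] at hG
    refine le_of_forall_pos_le_add fun ε hε => ?_
    have hab := hg.2.2.1
    have hpos : 0 < min (ε / 2) ((b - a) / 2) := lt_min (by linarith) (by linarith)
    have := hG _ ⟨b - min (ε / 2) ((b - a) / 2),
      ⟨by linarith [min_le_right (ε / 2) ((b - a) / 2)], by linarith⟩, rfl⟩ _
      (mem_unboundedGap_of_line hsub (s := M + ε / 2) (Or.inr (by linarith)))
    rw [lineIso.isometry.dist_eq, Real.dist_eq, abs_of_neg (by linarith [hM' hg.2.1])] at this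
    linarith [min_le_left (ε / 2) ((b - a) / 2)]
  · intro a b c d hg hg' hbc
    have hab := hg.2.2.1
    have hcd := hg'.2.2.1
    have hne : lineIso '' Ioo a b ≠ lineIso '' Ioo c d := fun h => by
      have h1 := (image_injective.2 lineIso.injective) h
      have h2 : (a + b) / 2 ∈ Ioo c d := h1 ▸ ⟨by linarith, by linarith⟩
      linarith [h2.1]
    have hG := hsep _ (image_lineIso_mem_boundedGaps hg) _
      (image_lineIso_mem_boundedGaps hg') hne
    rw [diam_image_lineIso_Ioo hab.le, diam_image_lineIso_Ioo hcd.le] at hG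
    refine le_of_forall_pos_le_add fun ε hε => ?_
    have hp1 : 0 < min (ε / 2) ((b - a) / 2) := lt_min (by linarith) (by linarith)
    have hp2 : 0 < min (ε / 2) ((d - c) / 2) := lt_min (by linarith) (by linarith)
    have := hG _ ⟨b - min (ε / 2) ((b - a) / 2),
      ⟨by linarith [min_le_right (ε / 2) ((b - a) / 2)], by linarith⟩, rfl⟩ _
      ⟨c + min (ε / 2) ((d - c) / 2),
      ⟨by linarith, by linarith [min_le_right (ε / 2) ((d - c) / 2)]⟩, rfl⟩
    rw [lineIso.isometry.dist_eq, Real.dist_eq, abs_of_neg (by linarith)] at this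
    linarith [min_le_left (ε / 2) ((b - a) / 2), min_le_left (ε / 2) ((d - c) / 2)]
  · obtain ⟨G, ⟨⟨x, hx, rfl⟩, hb⟩⟩ := hne
    rw [← lineIso.apply_symm_apply x] at hb hx
    have h1 : m ≤ lineIso.symm x := by
      by_contra! hc
      exact not_isBounded_pathComponentIn hsub (Or.inl hc) hb
    have h2 : lineIso.symm x ≤ M := by
      by_contra! hc
      exact not_isBounded_pathComponentIn hsub (Or.inr hc) hb
    obtain ⟨u, v, hg, -⟩ := exists_isGap hK.isClosed hm hM hx h1 h2
    exact ⟨u, v, hg⟩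

theorem eventually_exists_prodSet_line {C₁ C₂ : Set (Rd 1)} (hC₁ : IsCompact C₁)
    (hC₂ : IsCompact C₂) (hint₁ : interior C₁ = ∅) (hint₂ : interior C₂ = ∅)
    (hτ : 1 < thickness C₁ * thickness C₂) {x₀ : R2d 1} (hx₀ : x₀ ∈ prodSet C₁ C₂) :
    ∃ t₀ : ℝ, ∀ᶠ p : R2d 1 × ℝ in 𝓝 (x₀, t₀), ∃ y ∈ prodSet C₁ C₂, p.2 = ‖p.1 - y‖ := by
  -- Passing strictly below the thicknesses makes the constants finite, even if a thickness is `⊤`.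
  obtain ⟨σ₁, hσ₁, σ₂, hσ₂, hσ⟩ : ∃ σ₁ < thickness C₁, ∃ σ₂ < thickness C₂, 1 < σ₁ * σ₂ := by
    by_contra! hc
    exact hτ.not_ge (ENNReal.mul_le_of_forall_lt hc)
  have hσ' : 1 < σ₁.toReal * σ₂.toReal := by
    rw [← ENNReal.toReal_mul, ← ENNReal.toReal_one]
    exact ENNReal.toReal_strict_mono (ENNReal.mul_ne_top hσ₁.ne_top hσ₂.ne_top) hσ
  have hpos₁ : 0 < σ₁.toReal := pos_of_mul_pos_left (zero_lt_one.trans hσ') ENNReal.toReal_nonneg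
  have hpos₂ : 0 < σ₂.toReal := pos_of_mul_pos_right (zero_lt_one.trans hσ') ENNReal.toReal_nonneg
  obtain ⟨⟨m₁, M₁, h₁⟩, u₁, v₁, hg₁⟩ := exists_isThick_of_lt_thickness hC₁ hint₁ hpos₁
    (by rwa [ENNReal.ofReal_toReal hσ₁.ne_top])
  obtain ⟨⟨m₂, M₂, h₂⟩, u₂, v₂, hg₂⟩ := exists_isThick_of_lt_thickness hC₂ hint₂ hpos₂
    (by rwa [ENNReal.ofReal_toReal hσ₂.ne_top])
  have hi : ∀ C : Set (Rd 1), interior C = ∅ → interior (lineIso ⁻¹' C) = ∅ := fun C hC => by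
    have := lineIso.toHomeomorph.preimage_interior C
    rw [hC, preimage_empty] at this
    exact this.symm
  obtain ⟨s₀, hs₀, hev⟩ := h₁.eventually_exists_sq_add_sq h₂ hpos₁ hpos₂ hσ' (hi _ hint₁)
    (hi _ hint₂) hg₁ hg₂ (x₁ := lineIso.symm x₀.fst) (x₂ := lineIso.symm x₀.snd)
    (by simpa using hx₀.1) (by simpa using hx₀.2)
  have hc : Tendsto (fun p : R2d 1 × ℝ => ((lineIso.symm p.1.fst, lineIso.symm p.1.snd), p.2 ^ 2))
      (𝓝 (x₀, √s₀)) (𝓝 ((lineIso.symm x₀.fst, lineIso.symm x₀.snd), s₀)) := by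
    have : Continuous (fun p : R2d 1 × ℝ => ((lineIso.symm p.1.fst, lineIso.symm p.1.snd), p.2 ^ 2)) :=
      ((lineIso.symm.continuous.comp (by fun_prop)).prodMk (lineIso.symm.continuous.comp (by fun_prop))).prodMk
        (by fun_prop)
    simpa [Real.sq_sqrt hs₀.le] using this.tendsto (x₀, √s₀)
  refine ⟨√s₀, ?_⟩
  filter_upwards [hc.eventually hev, (continuous_snd.tendsto (x₀, √s₀)).eventually
    (lt_mem_nhds (Real.sqrt_pos.2 hs₀))] with p ⟨y₁, hy₁, y₂, hy₂, hp⟩ hp2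
  refine ⟨WithLp.toLp 2 (lineIso y₁, lineIso y₂), ⟨hy₁, hy₂⟩, ?_⟩
  have hnorm : ∀ (x : Rd 1) (y : ℝ), ‖x - lineIso y‖ ^ 2 = (y - lineIso.symm x) ^ 2 := fun x y => by
    rw [← dist_eq_norm, dist_comm, ← lineIso.symm.isometry.dist_eq, lineIso.symm_apply_apply, Real.dist_eq,
      sq_abs]
  refine eq_norm_sub_toLp _ _ _ (le_of_lt hp2) ?_
  rw [hnorm, hnorm, hp]

end Line

theorem mainTheorem2 (d : ℕ) (hd : 1 ≤ d) (C₁ C₂ : Set (Rd d))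
    (hC₁ : IsCompact C₁) (hC₂ : IsCompact C₂)
    (hτ : 1 < thickness C₁ * thickness C₂)
    (x₀ : R2d d) (hx₀ : x₀ ∈ prodSet C₁ C₂) :
    ∃ S : Set (R2d d), IsOpen S ∧ x₀ ∈ S ∧
      (interior (⋂ x ∈ S, pinnedDist x (prodSet C₁ C₂))).Nonempty := by
  suffices h : ∃ t₀ : ℝ, ∀ᶠ p : R2d d × ℝ in 𝓝 (x₀, t₀), ∃ y ∈ prodSet C₁ C₂, p.2 = ‖p.1 - y‖ from
    exists_interior_inter_pinnedDist h.choose_spec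
  rcases (interior C₁).eq_empty_or_nonempty with hint₁ | hint₁
  swap
  · obtain ⟨r, hr, h⟩ := exists_radius_of_interior_nonempty hd hint₁ x₀.fst
    exact ⟨r, eventually_exists_prodSet_of_fst hr hx₀.2 h⟩
  rcases (interior C₂).eq_empty_or_nonempty with hint₂ | hint₂
  swap
  · obtain ⟨r, hr, h⟩ := exists_radius_of_interior_nonempty hd hint₂ x₀.snd
    exact ⟨r, eventually_exists_prodSet_of_snd hr hx₀.1 h⟩
  rcases hd.eq_or_lt with rfl | hd2
  · exact eventually_exists_prodSet_line hC₁ hC₂ hint₁ hint₂ hτ hx₀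
  -- For `d ≥ 2` the product hypothesis serves only to make `thickness C₁` positive, through `0 * ⊤
  -- = 0`.
  · have hpos : 0 < thickness C₁ := pos_iff_ne_zero.2 fun h => by simp [h] at hτ
    obtain ⟨r, hr, h⟩ := exists_radius_of_thickness_pos hd2 hC₁ hint₁ hpos hx₀.1
    exact ⟨r, eventually_exists_prodSet_of_fst hr hx₀.2 h⟩
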